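/- All rings are associative and unital. A ring $S$ is called left (resp. right) pure semisimple if every left (resp. right) $S$-module is a direct sum of finitely generated submodules. Let $R$ be a (not necessarily commutative) ring and let $G$ be a finite group such that $|G|\cdot 1_R$ is a unit of $R$. Then $R$ is left pure semisimple if and only if the group ring $R[G]$ is left pure semisimple, and $R$ is right pure semisimple if and only if $R[G]$ is right pure semisimple. -/

import Mathlib

universe u v w

/-- A unital ring `S` is left pure semisimple if every left `S`-module is the (internal) direct sum
of a family of finitely generated submodules. The modules range over the universe `w`. -/
def IsLeftPureSemisimple (S : Type u) [Ring S] : Prop :=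
  ∀ (M : Type w) [AddCommGroup M] [Module S M],
    ∃ (ι : Type w) (_ : DecidableEq ι) (N : ι → Submodule S M),
      (∀ i, (N i).FG) ∧ DirectSum.IsInternal N

/-- A unital ring `S` is right pure semisimple if every right `S`-module (that is, every module
over the opposite ring) is the (internal) direct sum of a family of finitely generated
submodules. The modules range over the universe `w`. -/
def IsRightPureSemisimple (S : Type u) [Ring S] : Prop :=
  ∀ (M : Type w) [AddCommGroup M] [Module Sᵐᵒᵖ M],
    ∃ (ι : Type w) (_ : DecidableEq ι) (N : ι → Submodule Sᵐᵒᵖ M),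
      (∀ i, (N i).FG) ∧ DirectSum.IsInternal N

/-! Pure semisimplicity is traded for the condition that every module satisfies `IsFGResolvable`,
which passes easily between `R` and `R[G]`. From `R` to `R[G]`, the endomorphisms of a resolution
are averaged over `G` as in Maschke's theorem. From `R[G]` to `R`, a module is an `R`-retract of its
coinduced module, and a resolution of the latter is compressed along the retraction.

The main work is `isLeftPureSemisimple_of_forall_isFGResolvable`: if all modules are resolvable, all
are direct sums of finitely generated submodules. Chase's argument on countable products and a
cardinality count give `exists_retraction_of_tower`. Applied to towers of quotients and of powers of
an endomorphism, it makes `R` Noetherian and yields a Fitting lemma, hence a nonzero finitely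
generated summand in every nonzero module. Zorn's lemma on independent families of finitely
generated submodules with pure sum then finishes: a maximal sum splits off, and its complement must
vanish. -/

/-- The identity of `M` is a locally finite sum of endomorphisms, each with values in a finitely
generated submodule. Equivalently, `M` is a direct summand of a direct sum of finitely generated
modules. -/
def IsFGResolvable (S : Type u) [Ring S] (M : Type w) [AddCommGroup M] [Module S M] : Prop :=
  ∃ (ι : Type w) (e : ι → Module.End S M),
    (∀ i, ∃ N : Submodule S M, N.FG ∧ ∀ m, e i m ∈ N) ∧
    (∀ m, {i | e i m ≠ 0}.Finite) ∧ ∀ m, ∑ᶠ i, e i m = m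

/-- The linear maps `C → M` that extend along `φ : C → D`. -/
def extendableAlong {R : Type*} [Ring R] {C D : Type*} [AddCommGroup C] [Module R C]
    [AddCommGroup D] [Module R D] (φ : C →ₗ[R] D) (M : Type*) [AddCommGroup M] [Module R M] :
    AddSubgroup (C →ₗ[R] M) where
  carrier := {x | ∃ h : D →ₗ[R] M, h ∘ₗ φ = x}
  zero_mem' := ⟨0, LinearMap.zero_comp φ⟩
  add_mem' := by
    rintro _ _ ⟨h, rfl⟩ ⟨k, rfl⟩
    exact ⟨h + k, LinearMap.add_comp ..⟩
  neg_mem' := by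
    rintro _ ⟨h, rfl⟩
    exact ⟨-h, LinearMap.neg_comp ..⟩

/-! ### Chase's argument and retractions of towers -/

section Chase

variable {R : Type u} [Ring R]

theorem comp_finset_sum {C M M' ι : Type*} [AddCommGroup C] [Module R C]
    [AddCommGroup M] [Module R M] [AddCommGroup M'] [Module R M']
    (f : M →ₗ[R] M') (J : Finset ι) (y : ι → C →ₗ[R] M) :
    f ∘ₗ (∑ i ∈ J, y i) = ∑ i ∈ J, f ∘ₗ y i := by
  ext c
  simp [LinearMap.sum_apply]

theorem comp_mem_extendableAlong {C D M M' : Type*} [AddCommGroup C] [Module R C]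
    [AddCommGroup D] [Module R D] [AddCommGroup M] [Module R M] [AddCommGroup M'] [Module R M']
    {φ : C →ₗ[R] D} {x : C →ₗ[R] M} (hx : x ∈ extendableAlong φ M) (f : M →ₗ[R] M') :
    f ∘ₗ x ∈ extendableAlong φ M' := by
  obtain ⟨h, rfl⟩ := hx
  exact ⟨f ∘ₗ h, rfl⟩

theorem extendableAlong_comp_le {C D D' M : Type*} [AddCommGroup C] [Module R C]
    [AddCommGroup D] [Module R D] [AddCommGroup D'] [Module R D'] [AddCommGroup M] [Module R M]
    (φ : C →ₗ[R] D) (t : D →ₗ[R] D') :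
    extendableAlong (t ∘ₗ φ) M ≤ extendableAlong φ M := by
  rintro _ ⟨h, rfl⟩
  exact ⟨h ∘ₗ t, rfl⟩

theorem mem_extendableAlong_pi {C D : Type*} [AddCommGroup C] [Module R C]
    [AddCommGroup D] [Module R D] {φ : C →ₗ[R] D} {ι : Type*} {A : ι → Type*}
    [∀ i, AddCommGroup (A i)] [∀ i, Module R (A i)] {x : C →ₗ[R] (∀ i, A i)}
    (hx : ∀ i, LinearMap.proj i ∘ₗ x ∈ extendableAlong φ (A i)) :
    x ∈ extendableAlong φ (∀ i, A i) := by
  choose h hh using hx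
  refine ⟨LinearMap.pi h, ?_⟩
  ext c i
  exact LinearMap.congr_fun (hh i) c

/-- A linear map from a finitely generated module meets only finitely many members of a locally
finite family of endomorphisms. -/
theorem finite_setOf_comp_ne_zero {C M ι : Type*} [AddCommGroup C] [Module R C]
    [Module.Finite R C] [AddCommGroup M] [Module R M] {e : ι → Module.End R M}
    (he : ∀ m, {i | e i m ≠ 0}.Finite) (x : C →ₗ[R] M) : {i | e i ∘ₗ x ≠ 0}.Finite := by
  obtain ⟨s, hs⟩ := Module.Finite.fg_top (R := R) (M := C)
  refine (s.finite_toSet.biUnion fun c _ => he (x c)).subset fun i hi => ?_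
  by_contra hcon
  refine hi (LinearMap.ext_on hs fun c hc => ?_)
  by_contra hne
  exact hcon (Set.mem_biUnion hc hne)

theorem eq_sum_comp {C M ι : Type*} [AddCommGroup C] [Module R C]
    [AddCommGroup M] [Module R M] {e : ι → Module.End R M}
    (hsum : ∀ m, ∑ᶠ i, e i m = m) (x : C →ₗ[R] M) {J : Finset ι} (hJ : ∀ i ∉ J, e i ∘ₗ x = 0) :
    x = ∑ i ∈ J, e i ∘ₗ x := by
  ext c
  rw [LinearMap.sum_apply, ← finsum_eq_sum_of_support_subset]
  · exact (hsum (x c)).symm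
  · intro i hi
    by_contra hcon
    exact hi (LinearMap.congr_fun (hJ i hcon) c)

/-- Chase's lemma: a locally finite decomposition of the identity of a countable product is
concentrated, up to maps extendable arbitrarily far along a tower, on finitely many terms. -/
theorem exists_sub_sum_mem_extendableAlong {C : Type*} [AddCommGroup C] [Module R C]
    [Module.Finite R C] {D : ℕ → Type*} [∀ n, AddCommGroup (D n)] [∀ n, Module R (D n)]
    (φ : ∀ n, C →ₗ[R] D n) (hφ : ∀ n m, n ≤ m → ∃ t : D n →ₗ[R] D m, t ∘ₗ φ n = φ m)
    {A : ℕ → Type*} [∀ a, AddCommGroup (A a)] [∀ a, Module R (A a)]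
    {ι : Type*} {e : ι → Module.End R (∀ a, A a)}
    (hfin : ∀ m, {i | e i m ≠ 0}.Finite) (hsum : ∀ m, ∑ᶠ i, e i m = m) :
    ∃ (n : ℕ) (J : Finset ι), ∀ (m : ℕ) (x : C →ₗ[R] (∀ a, A a)),
      x ∈ extendableAlong (φ n) (∀ a, A a) → (∀ c, ∀ a < n, x c a = 0) →
      x - ∑ i ∈ J, e i ∘ₗ x ∈ extendableAlong (φ m) (∀ a, A a) := by
  classical
  have anti : ∀ {B : Type _} [AddCommGroup B] [Module R B] {n m : ℕ}, n ≤ m →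
      extendableAlong (φ m) B ≤ extendableAlong (φ n) B := by
    intro B _ _ n m h
    obtain ⟨t, ht⟩ := hφ n m h
    rw [← ht]
    exact extendableAlong_comp_le _ _
  have anti' : ∀ (a : ℕ) {n m : ℕ}, n ≤ m →
      extendableAlong (φ m) (A a) ≤ extendableAlong (φ n) (A a) := by
    intro a n m h
    obtain ⟨t, ht⟩ := hφ n m h
    rw [← ht]
    exact extendableAlong_comp_le _ _
  -- Otherwise every pair `(n, J)` has a counterexample; feeding these back recursively builds one
  -- map that meets infinitely many `e i`.
  by_contra! H
  choose m x hx hx0 hxm using H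
  let supp : (C →ₗ[R] (∀ a, A a)) → Finset ι := fun y => (finite_setOf_comp_ne_zero hfin y).toFinset
  have hsupp : ∀ y i, i ∉ supp y → e i ∘ₗ y = 0 := by
    intro y i hi
    simpa [supp] using hi
  -- `s k` holds the current stage and the indices met so far. The `+ 1` makes stages strictly
  -- increase, so `y k` vanishes in coordinates below `k`.
  let s : ℕ → ℕ × Finset ι := fun k => Nat.rec (0, ∅)
    (fun _ p => (max (m p.1 p.2) (p.1 + 1), p.2 ∪ supp (x p.1 p.2))) k
  let y : ℕ → C →ₗ[R] (∀ a, A a) := fun k => x (s k).1 (s k).2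
  have hs1 : ∀ k, (s (k + 1)).1 = max (m (s k).1 (s k).2) ((s k).1 + 1) := fun k => rfl
  have hs2 : ∀ k, (s (k + 1)).2 = (s k).2 ∪ supp (y k) := fun k => rfl
  have hmono1 : StrictMono fun k => (s k).1 := by
    refine strictMono_nat_of_lt_succ fun k => ?_
    rw [hs1]
    omega
  have hmono2 : Monotone fun k => (s k).2 := by
    refine monotone_nat_of_le_succ fun k => ?_
    rw [hs2]
    exact Finset.subset_union_left
  have hsub : ∀ {k l}, k < l → supp (y k) ⊆ (s l).2 := by
    intro k l h
    refine Finset.Subset.trans ?_ (hmono2 (Nat.succ_le_of_lt h))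
    change _ ⊆ (s (k + 1)).2
    rw [hs2]
    exact Finset.subset_union_right
  -- each step moves a new index out of the next stage of the tower
  have hj : ∀ k, ∃ i, i ∉ (s k).2 ∧
      e i ∘ₗ y k ∉ extendableAlong (φ (s (k + 1)).1) (∀ a, A a) := by
    intro k
    by_contra! hcon
    refine hxm (s k).1 (s k).2 (anti (n := m (s k).1 (s k).2) (m := (s (k + 1)).1) ?_ ?_)
    · rw [hs1]
      exact le_max_left _ _
    · have h1 : y k = ∑ i ∈ (s k).2 ∪ supp (y k), e i ∘ₗ y k :=
        eq_sum_comp hsum _ fun i hi => hsupp _ _ fun h => hi (Finset.mem_union_right _ h)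
      have h2 : y k - ∑ i ∈ (s k).2, e i ∘ₗ y k =
          ∑ i ∈ supp (y k) \ (s k).2, e i ∘ₗ y k := by
        nth_rewrite 1 [h1]
        rw [Finset.union_comm, ← Finset.sdiff_union_self_eq_union,
          Finset.sum_union Finset.sdiff_disjoint, add_sub_cancel_right]
      change y k - _ ∈ _
      rw [h2]
      exact sum_mem fun i hi => hcon i (Finset.mem_sdiff.1 hi).2
  choose j hjs hjy using hj
  have hjsupp : ∀ k, j k ∈ supp (y k) := by
    intro k
    by_contra hcon
    refine hjy k ?_
    rw [hsupp _ _ hcon]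
    exact zero_mem _
  have hjinj : Function.Injective j := by
    refine .of_lt_imp_ne fun k l hkl h => hjs l ?_
    rw [← h]
    exact hsub hkl (hjsupp k)
  have hy0 : ∀ k c a, a < k → y k c a = 0 := fun k c a h =>
    hx0 _ _ c a (h.trans_le (hmono1.id_le k))
  -- The infinite sum of all `y k`; in coordinate `a` only the terms `k ≤ a` survive.
  let X : C →ₗ[R] (∀ a, A a) :=
    LinearMap.pi fun a => ∑ k ∈ Finset.range (a + 1), LinearMap.proj a ∘ₗ y k
  have htail : ∀ k, X - ∑ l ∈ Finset.range (k + 1), y l ∈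
      extendableAlong (φ (s (k + 1)).1) (∀ a, A a) := by
    intro k
    refine mem_extendableAlong_pi fun a => ?_
    have : LinearMap.proj a ∘ₗ (X - ∑ l ∈ Finset.range (k + 1), y l) =
        ∑ l ∈ Finset.Ico (k + 1) (max (a + 1) (k + 1)), LinearMap.proj a ∘ₗ y l := by
      have hX : LinearMap.proj a ∘ₗ X =
          ∑ l ∈ Finset.range (max (a + 1) (k + 1)), LinearMap.proj a ∘ₗ y l := by
        rw [LinearMap.proj_pi]
        refine Finset.sum_subset (Finset.range_mono (le_max_left _ _)) fun l _ hl => ?_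
        ext c
        exact hy0 l c a (by simpa using hl)
      rw [LinearMap.comp_sub, hX, comp_finset_sum,
        Finset.sum_Ico_eq_sub _ (le_max_right _ _)]
    rw [this]
    refine sum_mem fun l hl => anti' a (m := (s l).1) ?_ ?_
    · exact hmono1.monotone (Finset.mem_Ico.1 hl).1
    · exact comp_mem_extendableAlong (hx _ _) _
  -- `e (j k)` kills the earlier `y l` and sends the tail to something extendable along stage `s (k
  -- + 1)`, whereas `e (j k) ∘ₗ y k` is not.
  have hne : ∀ k, e (j k) ∘ₗ X ≠ 0 := by
    intro k h0
    refine hjy k ?_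
    have h1 : e (j k) ∘ₗ (∑ l ∈ Finset.range (k + 1), y l) = e (j k) ∘ₗ y k := by
      rw [Finset.sum_range_succ, LinearMap.comp_add, comp_finset_sum,
        Finset.sum_eq_zero, zero_add]
      exact fun l hl => hsupp _ _ fun h => hjs k (hsub (Finset.mem_range.1 hl) h)
    have h2 := comp_mem_extendableAlong (htail k) (e (j k))
    rw [LinearMap.comp_sub, h0, h1, zero_sub] at h2
    exact neg_mem_iff.1 h2
  exact Set.infinite_of_injective_forall_mem hjinj hne (finite_setOf_comp_ne_zero hfin X)

/-- The linear maps between two finitely generated modules are fewer than the subsets of `ℕ → R`. -/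
theorem not_injective_setOf_linearMap {C N : Type*} [AddCommGroup C] [Module R C]
    [Module.Finite R C] [AddCommGroup N] [Module R N] [Module.Finite R N]
    (f : Set (ULift.{w} (ℕ → R)) → (C →ₗ[R] N)) : ¬ Function.Injective f := by
  intro hf
  obtain ⟨k, p, hp⟩ := Module.Finite.exists_fin' R C
  obtain ⟨l, q, hq⟩ := Module.Finite.exists_fin' R N
  let g : (C →ₗ[R] N) → Fin k → N := fun h i => h (p (Pi.single i 1))
  have hg : Function.Injective g := by
    intro h h' hh
    have : h ∘ₗ p = h' ∘ₗ p := by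
      refine LinearMap.pi_ext' fun i => LinearMap.ext_ring ?_
      simpa [g] using congrFun hh i
    exact (LinearMap.cancel_right hp).1 this
  -- One sequence codes, through `Nat.pair`, the coefficients of all `k` images, so `ULift (ℕ → R)`
  -- surjects onto a set containing the linear maps; Cantor's theorem applies.
  let r : ULift.{w} (ℕ → R) → Fin k → N := fun z i =>
    q fun t => z.down (Nat.pair i t)
  have hr : Function.Surjective r := by
    intro b
    choose a ha using fun i => hq (b i)
    refine ⟨⟨fun n => if h : n.unpair.1 < k ∧ n.unpair.2 < l then
      a ⟨_, h.1⟩ ⟨_, h.2⟩ else 0⟩, ?_⟩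
    ext i
    simp [r, ha]
  exact Function.cantor_surjective _ ((Function.invFun_surjective (hg.comp hf)).comp hr)

theorem exists_sum_mem_of_fg {M ι : Type*} [AddCommGroup M] [Module R M]
    {e : ι → Module.End R M} (he : ∀ i, ∃ N : Submodule R M, N.FG ∧ ∀ m, e i m ∈ N)
    (J : Finset ι) : ∃ N : Submodule R M, N.FG ∧ ∀ m, ∑ i ∈ J, e i m ∈ N := by
  choose N hN heN using he
  exact ⟨J.sup N, Submodule.fg_finset_sup J N fun i _ => hN i,
    fun m => sum_mem fun i hi => Finset.le_sup (f := N) hi (heN i m)⟩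

/-- Over a ring all of whose modules are resolvable, every tower under a finitely generated module
eventually retracts. -/
theorem exists_retraction_of_tower
    (hR : ∀ (M : Type (max u w)) [AddCommGroup M] [Module R M], IsFGResolvable R M)
    {C : Type*} [AddCommGroup C] [Module R C] [Module.Finite R C] {D : ℕ → Type (max u w)}
    [∀ n, AddCommGroup (D n)] [∀ n, Module R (D n)]
    (φ : ∀ n, C →ₗ[R] D n) (hφ : ∀ n m, n ≤ m → ∃ t : D n →ₗ[R] D m, t ∘ₗ φ n = φ m) :
    ∃ n, ∀ m, ∃ h : D m →ₗ[R] D n, h ∘ₗ φ m = φ n := by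
  classical
  let K := ULift.{w} (ℕ → R)
  -- The stage `n` is not known in advance, so each factor contains every `D n`; the `K` copies
  -- supply a map for each subset of `K`, too many for a finitely generated target.
  obtain ⟨ι, e, hfg, hfin, hsum⟩ := hR (ℕ → K → ∀ n, D n)
  obtain ⟨n, J, hJ⟩ := exists_sub_sum_mem_extendableAlong φ hφ hfin hsum
  refine ⟨n, fun m => ?_⟩
  by_contra hno
  let x : Set K → C →ₗ[R] (ℕ → K → ∀ n, D n) := fun s =>
    LinearMap.single R _ n ∘ₗ LinearMap.pi fun k => if k ∈ s then LinearMap.single R _ n ∘ₗ φ n else 0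
  have hx : ∀ s, x s ∈ extendableAlong (φ n) _ := fun s =>
    ⟨LinearMap.single R _ n ∘ₗ LinearMap.pi fun k =>
      if k ∈ s then LinearMap.single R _ n else 0, by
        rw [LinearMap.comp_assoc]
        congr 1
        ext c k : 2
        simp only [LinearMap.comp_apply, LinearMap.pi_apply]
        split_ifs <;> rfl⟩
  have hx0 : ∀ s c, ∀ a < n, x s c a = 0 := fun s c a ha => by
    simp [x, ha.ne]
  obtain ⟨N, hN, heN⟩ := exists_sum_mem_of_fg hfg J
  have := Module.Finite.iff_fg.2 hN
  let f : Set K → C →ₗ[R] N := fun s =>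
    (∑ i ∈ J, e i ∘ₗ x s).codRestrict N fun c => by
      simpa [LinearMap.sum_apply] using heN (x s c)
  -- If `f s = f s'`, then `x s - x s'` extends along `φ m`; a coordinate where `s` and `s'` differ
  -- would give the forbidden retraction.
  refine not_injective_setOf_linearMap f fun s s' hss => ?_
  have hsum_eq : ∑ i ∈ J, e i ∘ₗ x s = ∑ i ∈ J, e i ∘ₗ x s' := by
    ext1 c
    exact congrArg Subtype.val (LinearMap.congr_fun hss c)
  have hmem : x s - x s' ∈ extendableAlong (φ m) (ℕ → K → ∀ n, D n) := by
    have := sub_mem (hJ m _ (hx s) (hx0 s)) (hJ m _ (hx s') (hx0 s'))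
    rwa [hsum_eq, sub_sub_sub_cancel_right] at this
  have hcoord : ∀ k, LinearMap.proj n ∘ₗ LinearMap.proj k ∘ₗ LinearMap.proj n ∘ₗ (x s - x s') =
      (if k ∈ s then φ n else 0) - (if k ∈ s' then φ n else 0) := by
    intro k
    ext c
    by_cases h : k ∈ s <;> by_cases h' : k ∈ s' <;> simp [x, h, h']
  ext k
  have hk := comp_mem_extendableAlong hmem
    (LinearMap.proj n ∘ₗ LinearMap.proj k ∘ₗ LinearMap.proj n : (ℕ → K → ∀ n, D n) →ₗ[R] D n)
  rw [LinearMap.comp_assoc, LinearMap.comp_assoc, hcoord] at hk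
  by_contra hcon
  by_cases h : k ∈ s <;> by_cases h' : k ∈ s' <;> simp only [h, h', if_true, if_false,
    not_true, iff_self, sub_zero, zero_sub, neg_mem_iff] at hk hcon
  · exact hno hk
  · exact hno hk

end Chase

/-! ### Noetherianity, a Fitting lemma and finitely generated summands -/

section Noetherian

variable {R : Type u} [Ring R]

/-- For an ascending chain `N`, a map `C ⧸ N m → C ⧸ N n` compatible with the projections forces `N
m ≤ N n`. -/
theorem isNoetherian_of_forall_isFGResolvable
    (hR : ∀ (M : Type (max u w)) [AddCommGroup M] [Module R M], IsFGResolvable R M)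
    (C : Type (max u w)) [AddCommGroup C] [Module R C] [Module.Finite R C] :
    IsNoetherian R C := by
  rw [← monotone_stabilizes_iff_noetherian]
  intro N
  obtain ⟨n, hn⟩ := exists_retraction_of_tower.{u, w} hR (D := fun n => C ⧸ N n)
    (fun n => (N n).mkQ) fun n m h =>
      ⟨Submodule.factor (N.monotone h), Submodule.factor_comp_mk _⟩
  refine ⟨n, fun m hnm => le_antisymm (N.monotone hnm) ?_⟩
  obtain ⟨h, hh⟩ := hn m
  intro c hc
  have := LinearMap.congr_fun hh c
  rw [LinearMap.comp_apply, Submodule.mkQ_apply, (Submodule.Quotient.mk_eq_zero _).2 hc,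
    map_zero] at this
  exact (Submodule.Quotient.mk_eq_zero _).1 this.symm

theorem isNoetherianRing_of_forall_isFGResolvable
    (hR : ∀ (M : Type (max u w)) [AddCommGroup M] [Module R M], IsFGResolvable R M) :
    IsNoetherianRing R :=
  have := isNoetherian_of_forall_isFGResolvable.{u, w} hR (ULift.{w} R)
  isNoetherian_of_linearEquiv (ULift.moduleEquiv : ULift.{w} R ≃ₗ[R] R)

/-- If `h` undoes `f` on an `f`-stable submodule `N` of a Noetherian module, then `f` maps `N`
onto itself. -/
theorem map_eq_of_leftInverse_on {F : Type*} [AddCommGroup F] [Module R F] [IsNoetherian R F]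
    (f h : Module.End R F) (N : Submodule R F) (hfN : N.map f ≤ N) (hf : ∀ y ∈ N, h (f y) = y) :
    N.map f = N := by
  have hmap : (N.map f).map h = N := by
    rw [← Submodule.map_comp]
    ext y
    refine ⟨?_, fun hy => ⟨y, hy, hf y hy⟩⟩
    rintro ⟨z, hz, rfl⟩
    rw [LinearMap.comp_apply, hf z hz]
    exact hz
  have hle : N ≤ N.map h := hmap.symm.le.trans (Submodule.map_mono hfN)
  have hsucc : ∀ k, N.map (h ^ (k + 1)) = (N.map (h ^ k)).map h := fun k => by
    rw [pow_succ', Module.End.mul_eq_comp, Submodule.map_comp]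
  have hmono : Monotone fun k => N.map (h ^ k) := by
    refine monotone_nat_of_le_succ fun k => ?_
    induction k with
    | zero => simpa [Module.End.one_eq_id] using hle
    | succ k ih =>
      rw [hsucc (k + 1), hsucc k]
      exact Submodule.map_mono (ih.trans (hsucc k).le)
  obtain ⟨k, hk⟩ := monotone_stabilizes_iff_noetherian.2 ‹_› ⟨_, hmono⟩
  have hk' : N.map (h ^ k) = (N.map (h ^ k)).map h := by
    rw [← hsucc]
    exact hk (k + 1) k.le_succ
  -- `h` maps the stable value `L` onto itself, hence injectively by Noetherianity; cancelling `h`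
  -- step by step brings `L` back inside `N`.
  set L := N.map (h ^ k) with hL
  have hLmaps : ∀ y ∈ L, h y ∈ L := fun y hy => by
    rw [hk']
    exact ⟨y, hy, rfl⟩
  have hNL : N ≤ L := by simpa [Module.End.one_eq_id] using hmono (Nat.zero_le k)
  have hinj : Function.Injective (h.restrict hLmaps) := by
    refine IsNoetherian.injective_of_surjective_endomorphism _ ?_
    rintro ⟨y, hy⟩
    rw [hk'] at hy
    obtain ⟨z, hz, rfl⟩ := hy
    exact ⟨⟨z, hz⟩, rfl⟩
  have hinjOn : Set.InjOn h L := fun a ha b hb hab =>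
    congrArg Subtype.val (@hinj ⟨a, ha⟩ ⟨b, hb⟩ (Subtype.ext hab))
  have hdesc : ∀ i ≤ k, L ≤ N.map (h ^ i) → L ≤ N.map (h ^ 0) := by
    intro i
    induction i with
    | zero => exact fun _ h => h
    | succ i ih =>
      intro hi hLi
      refine ih (by omega) fun y hy => ?_
      obtain ⟨z, hz, hzy⟩ := (hsucc i).le (hLi (hLmaps y hy))
      rwa [← hinjOn (hmono (show i ≤ k by omega) hz) hy hzy]
  have hLN : L ≤ N := by simpa [Module.End.one_eq_id] using hdesc k le_rfl le_rfl
  refine le_antisymm hfN fun y hy => ?_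
  have : h y ∈ (N.map f).map h := hmap.symm ▸ hLN (hLmaps y (hNL hy))
  obtain ⟨z, hz, hzy⟩ := this
  rwa [← hinjOn (hNL (hfN hz)) (hNL hy) hzy]

/-- A Fitting-type lemma for finitely generated modules. -/
theorem exists_bijOn_range_pow
    (hR : ∀ (M : Type (max u w)) [AddCommGroup M] [Module R M], IsFGResolvable R M)
    {F : Type (max u w)} [AddCommGroup F] [Module R F] [Module.Finite R F]
    (f : Module.End R F) : ∃ n, Set.BijOn f (LinearMap.range (f ^ n)) (LinearMap.range (f ^ n)) := by
  have := isNoetherian_of_forall_isFGResolvable.{u, w} hR F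
  obtain ⟨n, hn⟩ := exists_retraction_of_tower.{u, w} hR (D := fun _ => F)
    (fun n => f ^ n) fun n m hnm => ⟨f ^ (m - n), by
      rw [← Module.End.mul_eq_comp, ← pow_add, Nat.sub_add_cancel hnm]⟩
  -- A retraction from stage `n + 1` to stage `n` is a left inverse of `f` on the range of `f ^ n`.
  obtain ⟨h, hh⟩ := hn (n + 1)
  have hleft : ∀ y ∈ LinearMap.range (f ^ n), h (f y) = y := by
    rintro _ ⟨z, rfl⟩
    have := LinearMap.congr_fun hh z
    rwa [pow_succ'] at this
  have hmaps : (LinearMap.range (f ^ n)).map f ≤ LinearMap.range (f ^ n) := by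
    rintro _ ⟨_, ⟨z, rfl⟩, rfl⟩
    refine ⟨f z, ?_⟩
    rw [← Module.End.mul_apply, ← Module.End.mul_apply, ← pow_succ, ← pow_succ']
  have heq := map_eq_of_leftInverse_on f h _ hmaps hleft
  refine ⟨n, fun y hy => hmaps ⟨y, hy, rfl⟩, fun a ha b hb hab => ?_, fun y hy => ?_⟩
  · rw [← hleft a ha, ← hleft b hb, hab]
  · exact heq.ge hy

/-- A nonzero module has a nonzero finitely generated direct summand. -/
theorem exists_fg_isCompl
    (hR : ∀ (M : Type (max u w)) [AddCommGroup M] [Module R M], IsFGResolvable R M)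
    (M : Type (max u w)) [AddCommGroup M] [Module R M] [Nontrivial M] :
    ∃ H H' : Submodule R M, H.FG ∧ H ≠ ⊥ ∧ IsCompl H H' := by
  have := isNoetherianRing_of_forall_isFGResolvable.{u, w} hR
  obtain ⟨x, hx⟩ := exists_ne (0 : M)
  obtain ⟨ι, e, hfg, hfin, hsum⟩ := hR M
  obtain ⟨F, hF, heF⟩ := exists_sum_mem_of_fg hfg (hfin x).toFinset
  have := Module.Finite.iff_fg.2 hF
  let β : M →ₗ[R] F := (∑ i ∈ (hfin x).toFinset, e i).codRestrict F fun m => by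
    simpa [LinearMap.sum_apply] using heF m
  have hβx : (β x : M) = x := by
    change (∑ i ∈ (hfin x).toFinset, e i) x = x
    rw [LinearMap.sum_apply, ← finsum_eq_sum_of_support_subset _ (by simp [Function.support])]
    exact hsum x
  -- `f` fixes the nonzero element `β x`, so the ranges of its powers never vanish.
  let f : Module.End R F := β ∘ₗ F.subtype
  have hfx : f (β x) = β x := by
    change β (β x : M) = β x
    rw [hβx]
  obtain ⟨n, hn⟩ := exists_bijOn_range_pow.{u, w} hR f
  have hpow : ∀ k, (f ^ k) (β x) = β x := fun k => by
    rw [Module.End.pow_apply]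
    exact Function.iterate_fixed hfx k
  -- `γ` maps `M` to `range (f ^ n)` and restricts to a bijection there
  let γ : M →ₗ[R] M := F.subtype ∘ₗ (f ^ n) ∘ₗ β
  let H : Submodule R M := (LinearMap.range (f ^ n)).map F.subtype
  have hγH : ∀ m, γ m ∈ H := fun m => ⟨_, ⟨β m, rfl⟩, rfl⟩
  have hγ : ∀ y : F, γ y = ((f ^ (n + 1)) y : F) := fun y => by
    rw [pow_succ]
    rfl
  have hbij : Set.BijOn (f ^ (n + 1) : Module.End R F) (LinearMap.range (f ^ n))
      (LinearMap.range (f ^ n)) := by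
    have := hn.iterate (n + 1)
    rwa [← Module.End.coe_pow] at this
  refine ⟨H, LinearMap.ker γ, (IsNoetherian.noetherian _).map _, ?_, ?_, ?_⟩
  · refine (Submodule.ne_bot_iff _).2 ⟨x, ⟨β x, ⟨β x, hpow n⟩, hβx⟩, hx⟩
  · rw [Submodule.disjoint_def]
    rintro _ ⟨y, hy, rfl⟩ hker
    have h1 : (f ^ (n + 1)) y = (f ^ (n + 1)) 0 := by
      rw [map_zero]
      exact Subtype.ext ((hγ y).symm.trans hker)
    rw [hbij.injOn hy (zero_mem _) h1, map_zero]
  · rw [codisjoint_iff, eq_top_iff]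
    intro m _
    obtain ⟨y, hy, hym⟩ := hbij.surjOn (show (f ^ n) (β m) ∈ _ from ⟨β m, rfl⟩)
    rw [← add_sub_cancel (y : M) m]
    refine Submodule.add_mem_sup ⟨y, hy, rfl⟩ ?_
    rw [LinearMap.mem_ker, map_sub, hγ y, hym]
    exact sub_self _

end Noetherian

/-! ### Pure submodules -/

section Pure

variable {R : Type u} [Ring R] {M : Type v} [AddCommGroup M] [Module R M]

/-- Every finitely generated submodule of the quotient `M ⧸ N` lifts to `M`. Over a Noetherian ring
this is purity of `N`. -/
def LiftsFGSubmodules (N : Submodule R M) : Prop :=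
  ∀ F : Submodule R (M ⧸ N), F.FG → ∃ l : F →ₗ[R] M, N.mkQ ∘ₗ l = F.subtype

theorem LiftsFGSubmodules.of_isCompl {N N' : Submodule R M} (h : IsCompl N N') :
    LiftsFGSubmodules N := fun F _ => by
  refine ⟨N'.subtype ∘ₗ (Submodule.quotientEquivOfIsCompl N N' h).toLinearMap ∘ₗ F.subtype, ?_⟩
  ext y
  exact (Submodule.quotientEquivOfIsCompl N N' h).symm_apply_apply y

theorem LiftsFGSubmodules.exists_lift {N : Submodule R M} (h : LiftsFGSubmodules N)
    {P : Type*} [AddCommGroup P] [Module R P] [Module.Finite R P] (g : P →ₗ[R] M ⧸ N) :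
    ∃ l : P →ₗ[R] M, N.mkQ ∘ₗ l = g := by
  obtain ⟨l, hl⟩ := h (LinearMap.range g) (by
    rw [← Submodule.map_top]
    exact Module.Finite.fg_top.map g)
  refine ⟨l ∘ₗ g.rangeRestrict, ?_⟩
  rw [← LinearMap.comp_assoc, hl]
  rfl

/-- Over a Noetherian ring `F` is finitely presented, so its inclusion into `M ⧸ sSup c` already
lifts to `M ⧸ N` for some `N ∈ c`. -/
theorem LiftsFGSubmodules.sSup_of_directedOn [IsNoetherianRing R] {c : Set (Submodule R M)}
    (hne : c.Nonempty) (hdir : DirectedOn (· ≤ ·) c) (hc : ∀ N ∈ c, LiftsFGSubmodules N) :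
    LiftsFGSubmodules (sSup c) := by
  intro F hF
  have := Module.Finite.iff_fg.2 hF
  obtain ⟨n, p, hp⟩ := Module.Finite.exists_fin' R F
  obtain ⟨q, hq⟩ := Module.projective_lifting_property (sSup c).mkQ (F.subtype ∘ₗ p)
    (Submodule.mkQ_surjective _)
  -- the relations of `F` already hold modulo a member of `c`
  have hker : (LinearMap.ker p).map q ≤ sSup c := by
    rintro _ ⟨z, hz, rfl⟩
    have := LinearMap.congr_fun hq z
    rw [LinearMap.comp_apply, LinearMap.comp_apply, LinearMap.mem_ker.1 hz, map_zero] at this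
    exact (Submodule.Quotient.mk_eq_zero _).1 this
  obtain ⟨N, hN, hNker⟩ := (Submodule.fg_iff_compact _).1
    ((IsNoetherian.noetherian (LinearMap.ker p)).map q) c _ hne hdir (isLUB_sSup c) hker
  let g : F →ₗ[R] M ⧸ N := (LinearMap.ker p).liftQ (N.mkQ ∘ₗ q) (by
    intro z hz
    exact (Submodule.Quotient.mk_eq_zero _).2 (hNker ⟨z, hz, rfl⟩)) ∘ₗ
      (p.quotKerEquivOfSurjective hp).symm.toLinearMap
  have hg : ∀ z, g (p z) = N.mkQ (q z) := by
    intro z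
    have : (p.quotKerEquivOfSurjective hp).symm (p z) = Submodule.Quotient.mk z := by
      rw [LinearEquiv.symm_apply_eq]
      rfl
    simp only [g, LinearMap.comp_apply, LinearEquiv.coe_coe, this]
    rfl
  obtain ⟨l, hl⟩ := (hc N hN).exists_lift g
  refine ⟨l, ?_⟩
  have hfac : (sSup c).mkQ = Submodule.factor (le_sSup hN) ∘ₗ N.mkQ :=
    (Submodule.factor_comp_mk _).symm
  rw [hfac, LinearMap.comp_assoc, hl]
  refine (LinearMap.cancel_right hp).1 (LinearMap.ext fun z => ?_)
  have hz := LinearMap.congr_fun hq z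
  rw [hfac] at hz
  simpa only [LinearMap.comp_apply, hg] using hz

/-- Each `e i` has finitely generated range and so lifts to `M`; the locally finite sum of the lifts
is a section of `N.mkQ`. -/
theorem LiftsFGSubmodules.exists_isCompl {N : Submodule R M} (h : LiftsFGSubmodules N)
    (hres : IsFGResolvable R (M ⧸ N)) : ∃ N', IsCompl N N' := by
  obtain ⟨ι, e, hfg, hfin, hsum⟩ := hres
  choose F hF heF using hfg
  choose l hl using fun i => h (F i) (hF i)
  let t : ι → (M ⧸ N) →ₗ[R] M := fun i => l i ∘ₗ (e i).codRestrict (F i) (heF i)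
  have ht : ∀ i y, N.mkQ (t i y) = e i y := fun i y =>
    LinearMap.congr_fun (hl i) ⟨e i y, heF i y⟩
  have htfin : ∀ y, (Function.support fun i => t i y).Finite := fun y =>
    (hfin y).subset fun i hi h0 => hi (by
      have : (e i).codRestrict (F i) (heF i) y = 0 := Subtype.ext h0
      simp [t, this])
  let s : (M ⧸ N) →ₗ[R] M :=
    { toFun := fun y => ∑ᶠ i, t i y
      map_add' := fun y z => by
        simp only [map_add]
        exact finsum_add_distrib (htfin y) (htfin z)
      map_smul' := fun r y => by
        simp only [map_smul, RingHom.id_apply]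
        exact (((DistribSMul.toAddMonoidHom M r).map_finsum (htfin y))).symm }
  have hs : ∀ y, N.mkQ (s y) = y := fun y => by
    change N.mkQ (∑ᶠ i, t i y) = y
    have hmap : N.mkQ (∑ᶠ i, t i y) = ∑ᶠ i, N.mkQ (t i y) :=
      N.mkQ.toAddMonoidHom.map_finsum (htfin y)
    rw [hmap, finsum_congr fun i => ht i y, hsum]
  refine ⟨LinearMap.range s, ?_, ?_⟩
  · rw [Submodule.disjoint_def]
    rintro _ hN ⟨y, rfl⟩
    have : y = 0 := (hs y).symm.trans ((Submodule.Quotient.mk_eq_zero _).2 hN)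
    rw [this, map_zero]
  · rw [codisjoint_iff, eq_top_iff]
    intro m _
    rw [← sub_add_cancel m (s (N.mkQ m))]
    refine Submodule.add_mem_sup ?_ ⟨_, rfl⟩
    refine (Submodule.Quotient.mk_eq_zero N).1 ?_
    change N.mkQ (m - s (N.mkQ m)) = 0
    rw [map_sub, hs, sub_self]

end Pure

/-! ### Decomposition into finitely generated summands -/

section Decomposition

theorem sSupIndep_insert_of_disjoint {α : Type*} [CompleteLattice α] [IsModularLattice α]
    {s : Set α} {a : α} (hs : sSupIndep s) (ha : Disjoint a (sSup s)) :
    sSupIndep (insert a s) := by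
  intro b hb
  by_cases hba : b = a
  · subst hba
    exact ha.mono_right (sSup_le_sSup (by simp))
  · have hbs : b ∈ s := hb.resolve_left hba
    have hle : b ⊔ sSup (s \ {b}) ≤ sSup s := sup_le (le_sSup hbs) (sSup_le_sSup Set.sdiff_subset)
    rw [Set.insert_sdiff_of_notMem _ (fun h => hba (Set.mem_singleton_iff.1 h).symm),
      sSup_insert, sup_comm]
    exact (hs hbs).disjoint_sup_right_of_disjoint_sup_left (ha.symm.mono_left hle)

variable {R : Type u} [Ring R]

theorem exists_sSupIndep_fg_sSup_eq_top
    (hR : ∀ (M : Type (max u w)) [AddCommGroup M] [Module R M], IsFGResolvable R M)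
    (M : Type (max u w)) [AddCommGroup M] [Module R M] :
    ∃ c : Set (Submodule R M), (∀ N ∈ c, N.FG) ∧ sSupIndep c ∧ sSup c = ⊤ := by
  have := isNoetherianRing_of_forall_isFGResolvable.{u, w} hR
  -- Purity, rather than splitting, is demanded of the sum because it survives unions of chains;
  -- resolvability of the quotient later turns it into splitting.
  obtain ⟨c, hc⟩ := zorn_subset {c : Set (Submodule R M) |
      (∀ N ∈ c, N.FG) ∧ sSupIndep c ∧ LiftsFGSubmodules (sSup c)} (by
    intro d hd hchain
    rcases d.eq_empty_or_nonempty with rfl | hne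
    · refine ⟨∅, ⟨by simp, sSupIndep_empty, ?_⟩, by simp⟩
      rw [sSup_empty]
      exact .of_isCompl isCompl_bot_top
    · refine ⟨⋃₀ d, ⟨?_, ?_, ?_⟩, fun _ => Set.subset_sUnion_of_mem⟩
      · rintro N ⟨c, hc, hN⟩
        exact (hd hc).1 N hN
      · exact iSupIndep_sUnion_of_directed hchain.directedOn fun c hc => (hd hc).2.1
      · rw [sSup_sUnion, ← sSup_image]
        refine .sSup_of_directedOn (hne.image _) ?_ ?_
        · rw [directedOn_image]
          exact hchain.directedOn.mono fun _ _ h => sSup_le_sSup h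
        · rintro _ ⟨c, hc, rfl⟩
          exact (hd hc).2.2)
  obtain ⟨⟨hfg, hind, hlift⟩, hmax⟩ := hc
  refine ⟨c, hfg, hind, ?_⟩
  obtain ⟨L, hL⟩ := hlift.exists_isCompl (hR _)
  rcases eq_or_ne L ⊥ with rfl | hLne
  · simpa using hL.sup_eq_top
  exfalso
  have := Submodule.nontrivial_iff_ne_bot.2 hLne
  obtain ⟨H, H', hH, hHne, hHH'⟩ := exists_fg_isCompl.{u, w} hR L
  have hsup : H.map L.subtype ⊔ H'.map L.subtype = L := by
    rw [← Submodule.map_sup, hHH'.sup_eq_top, Submodule.map_top, Submodule.range_subtype]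
  have hdisj : Disjoint (H.map L.subtype) (H'.map L.subtype) :=
    Submodule.disjoint_map L.injective_subtype hHH'.disjoint
  have hHdisj : Disjoint (H.map L.subtype) (sSup c) :=
    hL.disjoint.symm.mono_left (le_sup_left.trans hsup.le)
  -- A nonzero finitely generated summand `H` of the complement `L` enlarges the family: `H'`
  -- complements the new sum, which is therefore still pure.
  have hmem := hmax (y := insert (H.map L.subtype) c) ⟨?_, ?_, ?_⟩ (Set.subset_insert _ _)
    (Set.mem_insert _ _)
  · have hbot : H.map L.subtype = ⊥ := by
      simpa using hHdisj.mono_right (le_sSup hmem)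
    exact hHne (Submodule.map_injective_of_injective L.injective_subtype
      (hbot.trans (Submodule.map_bot _).symm))
  · rintro N (rfl | hN)
    · exact hH.map _
    · exact hfg N hN
  · exact sSupIndep_insert_of_disjoint hind hHdisj
  · rw [sSup_insert, sup_comm]
    refine .of_isCompl (N' := H'.map L.subtype) ⟨?_, ?_⟩
    · refine hdisj.disjoint_sup_left_of_disjoint_sup_right ?_
      rw [hsup]
      exact hL.disjoint
    · rw [codisjoint_iff, sup_assoc, hsup]
      exact hL.sup_eq_top

theorem isLeftPureSemisimple_of_forall_isFGResolvable
    (hR : ∀ (M : Type (max u w)) [AddCommGroup M] [Module R M], IsFGResolvable R M) :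
    IsLeftPureSemisimple.{u, max u w} R := by
  classical
  intro M _ _
  obtain ⟨c, hfg, hind, htop⟩ := exists_sSupIndep_fg_sSup_eq_top.{u, w} hR M
  refine ⟨c, inferInstance, Subtype.val, fun N => hfg N N.2,
    DirectSum.isInternal_submodule_of_iSupIndep_of_iSup_eq_top ((sSupIndep_iff c).1 hind) ?_⟩
  rw [← sSup_eq_iSup', htop]

theorem IsLeftPureSemisimple.isFGResolvable (hR : IsLeftPureSemisimple.{u, v} R)
    (M : Type v) [AddCommGroup M] [Module R M] : IsFGResolvable R M := by
  classical
  obtain ⟨ι, dec, N, hfg, hint⟩ := hR M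
  let E := LinearEquiv.ofBijective (DirectSum.coeLinearMap N) hint
  refine ⟨ι, fun i => (N i).subtype ∘ₗ DirectSum.component R ι (fun i => N i) i ∘ₗ
    E.symm.toLinearMap, fun i => ⟨N i, hfg i, fun m => Subtype.prop _⟩, fun m => ?_, fun m => ?_⟩
  · refine (DFinsupp.support (E.symm m)).finite_toSet.subset fun i hi => ?_
    simp only [Finset.mem_coe, DFinsupp.mem_support_toFun]
    intro h0
    refine hi ?_
    change ((E.symm m i : N i) : M) = 0
    rw [h0]
    rfl
  · rw [finsum_eq_sum_of_support_subset (s := DFinsupp.support (E.symm m))]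
    · have h := E.apply_symm_apply m
      change DirectSum.coeLinearMap N (E.symm m) = m at h
      rw [DirectSum.coeLinearMap_eq_dfinsuppSum] at h
      exact h
    · intro i hi
      simp only [Finset.mem_coe, DFinsupp.mem_support_toFun]
      intro h0
      refine hi ?_
      change ((E.symm m i : N i) : M) = 0
      rw [h0]
      rfl

end Decomposition

/-! ### Invariance under ring isomorphism -/

section Transfer

theorem IsLeftPureSemisimple.of_ringEquiv {R : Type u} {S : Type v} [Ring R] [Ring S]
    (E : R ≃+* S) (hR : IsLeftPureSemisimple.{u, w} R) : IsLeftPureSemisimple.{v, w} S := by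
  intro M _ _
  let : Module R M := Module.compHom M (E : R →+* S)
  obtain ⟨ι, dec, N, hfg, hint⟩ := hR M
  have hmem : ∀ (N : Submodule R M) (s : S) {m : M}, m ∈ N → s • m ∈ N := by
    intro N s m hm
    have : E.symm s • m ∈ N := N.smul_mem _ hm
    change E (E.symm s) • m ∈ N at this
    rwa [E.apply_symm_apply] at this
  let T : Submodule R M → Submodule S M := fun N =>
    { N with smul_mem' := fun s _ hm => hmem N s hm }
  refine ⟨ι, dec, fun i => T (N i), fun i => ?_, hint⟩
  obtain ⟨s, hs⟩ := hfg i
  refine ⟨s, le_antisymm (Submodule.span_le.2 fun m hm => ?_) fun m hm => ?_⟩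
  · have : m ∈ Submodule.span R (s : Set M) := Submodule.subset_span hm
    rwa [hs] at this
  · have hm' : m ∈ Submodule.span R (s : Set M) := by rwa [hs]
    induction hm' using Submodule.span_induction with
    | mem x hx => exact Submodule.subset_span hx
    | zero => exact zero_mem _
    | add x y hx hy ihx ihy =>
      exact add_mem (ihx (hs.le hx)) (ihy (hs.le hy))
    | smul r x hx ih => exact Submodule.smul_mem _ (E r) (ih (hs.le hx))

end Transfer

/-! ### Averaging: from `R` to `R[G]` -/

-- Each conjugate of the resolution by an element of `G` still sums to the identity, so the average
-- does too; averaging makes each term `R[G]`-linear.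
open MonoidAlgebra in
theorem MonoidAlgebra.isFGResolvable_of_compHom {R : Type u} [Ring R] {G : Type v} [Group G]
    [Finite G] (hG : IsUnit ((Nat.card G : ℕ) : R)) (M : Type w) [AddCommGroup M]
    [Module (MonoidAlgebra R G) M]
    (hM : letI : Module R M := Module.compHom M (singleOneRingHom : R →+* MonoidAlgebra R G)
      IsFGResolvable R M) :
    IsFGResolvable (MonoidAlgebra R G) M := by
  classical
  have := Fintype.ofFinite G
  let : Module R M := Module.compHom M (singleOneRingHom : R →+* MonoidAlgebra R G)
  have smul_def : ∀ (r : R) (m : M), r • m = (single 1 r : MonoidAlgebra R G) • m :=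
    fun _ _ => rfl
  obtain ⟨ι, e, hfg, hfin, hsum⟩ := hM
  obtain ⟨q, hq⟩ := hG
  let c : R := ↑q⁻¹
  -- As the inverse of an integer, `c` is central, so scaling by it is `R`-linear.
  have hc : ∀ r : R, c * r = r * c := fun r => by
    have : Commute (q : R) r := hq ▸ Nat.cast_commute _ r
    exact this.units_inv_left
  let γ : G → MonoidAlgebra R G := fun g => single g 1
  -- the average of `e i` over conjugation by `G`
  let a : ι → M → M := fun i m => c • ∑ g, γ g • e i (γ g⁻¹ • m)
  have hr : ∀ (r : R) (g : G) (m : M), γ g • (r • m) = r • (γ g • m) := fun r g m => by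
    simp only [γ, smul_def, smul_smul, single_mul_single, mul_one, one_mul]
  have hγ : ∀ (g h : G) (m : M), γ g • γ h • m = γ (g * h) • m := fun g h m => by
    simp only [γ, smul_smul, single_mul_single, mul_one]
  have hsingle : ∀ (g : G) (r : R) (m : M),
      (single g r : MonoidAlgebra R G) • m = r • (γ g • m) := fun g r m => by
    simp only [γ, smul_def, smul_smul, single_mul_single, mul_one, one_mul]
  have ha_add : ∀ i m m', a i (m + m') = a i m + a i m' := fun i m m' => by
    simp only [a, smul_add, map_add, Finset.sum_add_distrib]
  have ha_r : ∀ i (r : R) m, a i (r • m) = r • a i m := fun i r m => by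
    simp only [a, hr, map_smul, ← Finset.smul_sum]
    rw [smul_smul, smul_smul, hc]
  have ha_g : ∀ i (h : G) m, a i (γ h • m) = γ h • a i m := fun i h m => by
    simp only [a]
    rw [hr]
    refine congrArg (fun z : M => c • z) ?_
    rw [Finset.smul_sum]
    refine (Fintype.sum_equiv (Equiv.mulLeft h) _ _ fun g => ?_).symm
    rw [Equiv.coe_mulLeft, hγ, hγ, mul_inv_rev, inv_mul_cancel_right]
  have ha_smul : ∀ i (x : MonoidAlgebra R G) m, a i (x • m) = x • a i m := fun i x m => by
    induction x using MonoidAlgebra.induction_linear with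
    | zero => simp [a]
    | add x y hx hy => rw [add_smul, add_smul, ha_add, hx, hy]
    | single g r => rw [hsingle g r m, hsingle g r (a i m), ha_r, ha_g]
  refine ⟨ι, fun i => ⟨⟨a i, ha_add i⟩, ha_smul i⟩, fun i => ?_, fun m => ?_, fun m => ?_⟩
  · obtain ⟨N, ⟨s, hs⟩, heN⟩ := hfg i
    refine ⟨Submodule.span _ (s : Set M), ⟨s, rfl⟩, fun m => ?_⟩
    have hle : ∀ m ∈ N, m ∈ Submodule.span (MonoidAlgebra R G) (s : Set M) := by
      intro m hm
      rw [← hs] at hm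
      induction hm using Submodule.span_induction with
      | mem x hx => exact Submodule.subset_span hx
      | zero => exact zero_mem _
      | add x y _ _ ihx ihy => exact add_mem ihx ihy
      | smul r x _ ih => exact Submodule.smul_mem _ _ ih
    refine Submodule.smul_mem _ (single 1 c : MonoidAlgebra R G) (sum_mem fun g _ => ?_)
    exact Submodule.smul_mem _ _ (hle _ (heN _))
  · refine (Set.finite_iUnion fun g : G => hfin (γ g⁻¹ • m)).subset fun i hi => ?_
    by_contra hcon
    simp only [Set.mem_iUnion, not_exists, Set.mem_ofPred_eq, not_not] at hcon
    exact hi (by simp [a, hcon])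
  · have hfinite : ∀ g : G, (Function.support fun i => γ g • e i (γ g⁻¹ • m)).Finite := fun g =>
      (hfin (γ g⁻¹ • m)).subset fun i hi h0 => hi (by
        change γ g • e i (γ g⁻¹ • m) = 0
        rw [h0, smul_zero])
    have hone : ∀ g : G, ∑ᶠ i, γ g • e i (γ g⁻¹ • m) = m := fun g => by
      have := (DistribSMul.toAddMonoidHom M (γ g)).map_finsum (hfin (γ g⁻¹ • m))
      simp only [DistribSMul.toAddMonoidHom_apply] at this
      rw [← this, hsum, hγ, mul_inv_cancel]
      exact one_smul _ m
    have hsupp : (Function.support fun i => ∑ g, γ g • e i (γ g⁻¹ • m)).Finite := by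
      refine (Set.finite_iUnion hfinite).subset fun i hi => ?_
      by_contra hcon
      simp only [Set.mem_iUnion, not_exists, Function.mem_support, not_not] at hcon
      exact hi (Finset.sum_eq_zero fun g _ => hcon g)
    change ∑ᶠ i, c • ∑ g, γ g • e i (γ g⁻¹ • m) = m
    have := (DistribSMul.toAddMonoidHom M c).map_finsum hsupp
    simp only [DistribSMul.toAddMonoidHom_apply] at this
    rw [← this, finsum_sum_comm _ _ fun g _ => hfinite g]
    simp only [hone, Finset.sum_const, Finset.card_univ]
    rw [← Nat.card_eq_fintype_card, ← Nat.cast_smul_eq_nsmul R, ← hq, smul_smul]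
    simp [c]

/-! ### Coinduction: from `R[G]` to `R` -/

namespace MonoidAlgebra

/-- The `R[G]`-module coinduced from the `R`-module `M`. -/
def Coinduced (R : Type u) [Ring R] (G : Type v) [Monoid G] (M : Type w)
    [AddCommGroup M] [Module R M] : Type (max u v w) :=
  MonoidAlgebra R G →ₗ[R] M

namespace Coinduced

variable {R : Type u} [Ring R] {G : Type v} [Monoid G] {M : Type w} [AddCommGroup M] [Module R M]

noncomputable instance : AddCommGroup (Coinduced R G M) :=
  inferInstanceAs (AddCommGroup (MonoidAlgebra R G →ₗ[R] M))

instance : FunLike (Coinduced R G M) (MonoidAlgebra R G) M :=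
  inferInstanceAs (FunLike (MonoidAlgebra R G →ₗ[R] M) _ _)

instance : LinearMapClass (Coinduced R G M) R (MonoidAlgebra R G) M :=
  inferInstanceAs (LinearMapClass (MonoidAlgebra R G →ₗ[R] M) R _ _)

noncomputable instance : SMul (MonoidAlgebra R G) (Coinduced R G M) where
  smul s f :=
    ({ toFun := fun x => f (x * s)
       map_add' := fun x y => by rw [add_mul, map_add]
       map_smul' := fun r x => by rw [smul_mul_assoc, map_smul, RingHom.id_apply] } :
      MonoidAlgebra R G →ₗ[R] M)

theorem add_apply (f g : Coinduced R G M) (x : MonoidAlgebra R G) : (f + g) x = f x + g x := rfl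

theorem zero_apply (x : MonoidAlgebra R G) : (0 : Coinduced R G M) x = 0 := rfl

theorem smul_apply (s : MonoidAlgebra R G) (f : Coinduced R G M) (x : MonoidAlgebra R G) :
    (s • f) x = f (x * s) := rfl

noncomputable instance : Module (MonoidAlgebra R G) (Coinduced R G M) where
  one_smul f := DFunLike.ext _ _ fun x => by rw [smul_apply, mul_one]
  mul_smul s t f := DFunLike.ext _ _ fun x => by simp only [smul_apply, mul_assoc]
  smul_zero s := rfl
  smul_add s f g := rfl
  add_smul s t f := DFunLike.ext _ _ fun x => by
    rw [smul_apply, add_apply, mul_add, map_add, smul_apply, smul_apply]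
  zero_smul f := DFunLike.ext _ _ fun x => by rw [smul_apply, mul_zero, map_zero, zero_apply]

/-- Evaluation at `1`. -/
noncomputable def eval : Coinduced R G M →+ M where
  toFun f := f 1
  map_zero' := rfl
  map_add' _ _ := rfl

/-- `R` acts on the coinduced module through `single 1 r`; together with `incl_smul` this makes `M`
an `R`-retract. -/
theorem eval_single_one_smul (r : R) (f : Coinduced R G M) :
    eval ((single 1 r : MonoidAlgebra R G) • f) = r • eval f := by
  change f (1 * single 1 r) = r • f 1
  rw [← map_smul, one_mul, one_def, smul_single, smul_eq_mul, mul_one]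

/-- The embedding `M → Coinduced R G M` sending `m` to `x ↦ x(1) m`. -/
def incl (m : M) : Coinduced R G M :=
  ({ toFun := fun x => x.coeff 1 • m
     map_add' := fun x y => by simp [add_smul]
     map_smul' := fun r x => by simp [mul_smul] } : MonoidAlgebra R G →ₗ[R] M)

theorem incl_apply (m : M) (x : MonoidAlgebra R G) : incl m x = x.coeff 1 • m := rfl

theorem incl_add (m m' : M) : (incl (m + m') : Coinduced R G M) = incl m + incl m' :=
  DFunLike.ext _ _ fun _ => smul_add _ _ _

theorem eval_incl (m : M) : eval (incl m : Coinduced R G M) = m := by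
  change (1 : MonoidAlgebra R G).coeff 1 • m = m
  simp [one_def]

theorem incl_smul {G : Type v} [Group G] (r : R) (m : M) :
    (incl (r • m) : Coinduced R G M) = (single 1 r : MonoidAlgebra R G) • incl m :=
  DFunLike.ext _ _ fun x => by
    rw [smul_apply, incl_apply, incl_apply, smul_smul]
    congr 1
    simp

/-- The values of the finitely many generators at the finitely many group elements suffice, since
`R[G]` acts by translating the argument. -/
theorem exists_fg_forall_apply_mem [Finite G] {N : Submodule (MonoidAlgebra R G) (Coinduced R G M)}
    (hN : N.FG) : ∃ P : Submodule R M, P.FG ∧ ∀ f ∈ N, ∀ x, f x ∈ P := by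
  obtain ⟨s, rfl⟩ := hN
  refine ⟨Submodule.span R
    ((fun p : Coinduced R G M × G => p.1 (single p.2 1)) '' ((s : Set _) ×ˢ Set.univ)),
    Submodule.fg_span ((s.finite_toSet.prod Set.finite_univ).image _), fun f hf => ?_⟩
  induction hf using Submodule.span_induction with
  | mem t ht =>
    intro x
    induction x using MonoidAlgebra.induction_linear with
    | zero => rw [map_zero]; exact zero_mem _
    | add x y hx hy => rw [map_add]; exact add_mem hx hy
    | single g r =>
      have : (single g r : MonoidAlgebra R G) = r • single g 1 := by simp
      rw [this, map_smul]
      exact Submodule.smul_mem _ _ (Submodule.subset_span ⟨(t, g), ⟨ht, trivial⟩, rfl⟩)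
  | zero => exact fun x => zero_mem _
  | add t t' _ _ ih ih' => exact fun x => add_mem (ih x) (ih' x)
  | smul y t _ ih => exact fun x => ih (x * y)

/-- The resolution of `M` is `eval ∘ e i ∘ incl`, and `eval ∘ incl` is the identity. -/
theorem isFGResolvable {G : Type v} [Group G] [Finite G] {M : Type (max u v w)}
    [AddCommGroup M] [Module R M]
    (h : IsFGResolvable.{max u v, max u v w} (MonoidAlgebra R G) (Coinduced R G M)) :
    IsFGResolvable R M := by
  obtain ⟨ι, e, hfg, hfin, hsum⟩ := h
  refine ⟨ι, fun i =>
    { toFun := fun m => eval (e i (incl m))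
      map_add' := fun m m' => by rw [incl_add, map_add, map_add]
      map_smul' := fun r m => by
        rw [incl_smul, map_smul, eval_single_one_smul, RingHom.id_apply] }, fun i => ?_,
    fun m => ?_, fun m => ?_⟩
  · obtain ⟨N, hN, heN⟩ := hfg i
    obtain ⟨P, hP, hNP⟩ := exists_fg_forall_apply_mem hN
    exact ⟨P, hP, fun m => hNP _ (heN _) 1⟩
  · refine (hfin (incl m)).subset fun i hi h0 => hi ?_
    change eval (e i (incl m)) = 0
    rw [h0, map_zero]
  · change ∑ᶠ i, eval (e i (incl m)) = m
    rw [← AddMonoidHom.map_finsum _ (hfin (incl m)), hsum, eval_incl]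

end Coinduced

end MonoidAlgebra

/-! ### The equivalence for left and right modules -/

theorem isLeftPureSemisimple_iff_monoidAlgebra (R : Type u) [Ring R] (G : Type v) [Group G]
    [Finite G] (hG : IsUnit ((Nat.card G : ℕ) : R)) :
    IsLeftPureSemisimple.{u, max u v w} R ↔
      IsLeftPureSemisimple.{max u v, max u v w} (MonoidAlgebra R G) := by
  refine ⟨fun h => ?_, fun h => ?_⟩
  · refine isLeftPureSemisimple_of_forall_isFGResolvable.{max u v, w} fun M _ _ => ?_
    let : Module R M :=
      Module.compHom M (MonoidAlgebra.singleOneRingHom : R →+* MonoidAlgebra R G)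
    exact MonoidAlgebra.isFGResolvable_of_compHom hG M (h.isFGResolvable M)
  · refine isLeftPureSemisimple_of_forall_isFGResolvable.{u, max v w} fun M _ _ => ?_
    exact MonoidAlgebra.Coinduced.isFGResolvable.{u, v, w} (G := G) (h.isFGResolvable _)

theorem theorem1p3 (R : Type u) [Ring R] (G : Type v) [Group G] [Finite G]
    (hG : IsUnit ((Nat.card G : ℕ) : R)) :
    (IsLeftPureSemisimple.{u, max u v w} R ↔
      IsLeftPureSemisimple.{max u v, max u v w} (MonoidAlgebra R G)) ∧
    (IsRightPureSemisimple.{u, max u v w} R ↔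
      IsRightPureSemisimple.{max u v, max u v w} (MonoidAlgebra R G)) := by
  refine ⟨isLeftPureSemisimple_iff_monoidAlgebra.{u, v, w} R G hG, ?_⟩
  have : Finite Gᵐᵒᵖ := .of_equiv G MulOpposite.opEquiv
  have hG' : IsUnit ((Nat.card Gᵐᵒᵖ : ℕ) : Rᵐᵒᵖ) := by
    rw [Nat.card_congr MulOpposite.opEquiv.symm, ← MulOpposite.op_natCast]
    exact hG.op
  -- Right `R[G]`-modules are left modules over the opposite of `R[G]`, which is the group ring of
  -- `Gᵐᵒᵖ` over `Rᵐᵒᵖ`.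
  exact (isLeftPureSemisimple_iff_monoidAlgebra.{u, v, w} Rᵐᵒᵖ Gᵐᵒᵖ hG').trans
    ⟨IsLeftPureSemisimple.of_ringEquiv MonoidAlgebra.opRingEquiv.symm,
      IsLeftPureSemisimple.of_ringEquiv MonoidAlgebra.opRingEquiv⟩
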